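/- **Theorem (God's Number grows as $\Omega(n^2/\log n)$).** Consider the $n\times n\times n$ Rubik's Cube with its $6n^2$ stickers, each having the colour of the face on which it lies in the solved state. A basic move is a rotation by $90^\circ$, in either sense, of one of the $3n$ slices ($n\times n\times 1$ layers); there are $6n$ basic moves. The orientation of the whole cube in space is kept fixed. A valid configuration is a colouring of the $6n^2$ sticker places that can be obtained from the solved state by a finite sequence of moves; configurations that look the same are identified. God's Number $g(n)$ is the least $k$ such that every valid configuration can be brought to the solved state by a sequence of at most $k$ moves. Then $$g(n)=\Omega\!\left(\frac{n^2}{\log n}\right)\qquad(n\to\infty),$$ that is, there are a constant $c>0$ and an $N$ such that $g(n)\ge c\,n^2/\log n$ for all $n\ge N$. This holds both if all $6n$ basic moves are allowed and if, for odd $n$, the rotations of the three central slices are not allowed (in defining both the valid configurations and God's Number). -/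

import Mathlib

open Filter Asymptotics

namespace RubikCube

/-- An outward direction of an axis-parallel cube in three-space: the axis `0`, `1`, `2`, together
with `true` for the positive and `false` for the negative direction. The six directions name
the six faces of the cube, and also the six colours. -/
abbrev Face : Type := Fin 3 × Bool

/-- The cell `p` (with coordinates `0, …, n - 1`) lies in the layer next to the face `f`. -/
def OnFace {n : ℕ} (p : Fin 3 → Fin n) (f : Face) : Prop :=
  (p f.1 : ℕ) = if f.2 then n - 1 else 0

/-- The stickers (more precisely the sticker places) of the `n × n × n` cube: a cubie given by its
three coordinates, and a face of the cube on which this cubie has a sticker. -/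
def Sticker (n : ℕ) : Type := {x : (Fin 3 → Fin n) × Face // OnFace x.1 x.2}

/-- The coordinates of the cubie that carries the sticker. -/
def Sticker.pos {n : ℕ} (x : Sticker n) : Fin 3 → Fin n := x.1.1

/-- The face of the cube on which the sticker lies. -/
def Sticker.face {n : ℕ} (x : Sticker n) : Face := x.1.2

/-- Rotation of the cells by a quarter turn about the axis `a`: with the origin at the centre of
the cube it is `(x_a, x_{a+1}, x_{a+2}) ↦ (x_a, -x_{a+2}, x_{a+1})`, where
`Fin.rev i = n - 1 - i` is the reflection of a coordinate. -/
def rotPos {n : ℕ} (a : Fin 3) (p : Fin 3 → Fin n) : Fin 3 → Fin n := fun i =>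
  if i = a then p a else if i = a + 1 then (p (a + 2)).rev else p (a + 1)

/-- The same quarter turn on outward directions: `±e_{a+1} ↦ ±e_{a+2}`, `±e_{a+2} ↦ ∓e_{a+1}`. -/
def rotFace (a : Fin 3) (f : Face) : Face :=
  if f.1 = a then f else if f.1 = a + 1 then (a + 2, f.2) else (a + 1, !f.2)

theorem onFace_rot {n : ℕ} (a : Fin 3) (p : Fin 3 → Fin n) (f : Face) (h : OnFace p f) :
    OnFace (rotPos a p) (rotFace a f) := by
  obtain ⟨i, s⟩ := f
  fin_cases a <;> fin_cases i <;> cases s <;>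
    simp_all [OnFace, rotPos, rotFace, Fin.val_rev] <;> omega

theorem rotPos_four {n : ℕ} (a : Fin 3) (p : Fin 3 → Fin n) :
    rotPos a (rotPos a (rotPos a (rotPos a p))) = p := by
  funext i
  fin_cases a <;> fin_cases i <;> simp [rotPos]

theorem rotFace_four (a : Fin 3) (f : Face) :
    rotFace a (rotFace a (rotFace a (rotFace a f))) = f := by
  revert a f; decide

/-- A quarter turn of the slice of cubies whose coordinate along the axis `a` is `k`; all other
stickers stay where they are. -/
def turnFun {n : ℕ} (a : Fin 3) (k : Fin n) (x : Sticker n) : Sticker n :=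
  if x.pos a = k then ⟨(rotPos a x.pos, rotFace a x.face), onFace_rot a _ _ x.2⟩ else x

theorem turnFun_four {n : ℕ} (a : Fin 3) (k : Fin n) (x : Sticker n) :
    turnFun a k (turnFun a k (turnFun a k (turnFun a k x))) = x := by
  by_cases h : x.pos a = k
  · have h' : x.1.1 a = k := h
    apply Subtype.ext
    apply Prod.ext
    · simpa [turnFun, Sticker.pos, Sticker.face, h', rotPos] using rotPos_four a x.1.1
    · simpa [turnFun, Sticker.pos, Sticker.face, h', rotPos] using rotFace_four a x.1.2
  · simp [turnFun, h]

/-- The quarter turn of a slice as a permutation of the `6 n ^ 2` stickers. -/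
def quarterTurn {n : ℕ} (a : Fin 3) (k : Fin n) : Equiv.Perm (Sticker n) where
  toFun := turnFun a k
  invFun x := turnFun a k (turnFun a k (turnFun a k x))
  left_inv := turnFun_four a k
  right_inv := turnFun_four a k

/-- A basic move: a slice (an axis and a coordinate along it) and a sense of rotation. There are
`3 n` slices and `6 n` basic moves. -/
structure Move (n : ℕ) where
  axis : Fin 3
  layer : Fin n
  sense : Bool

/-- The permutation of the stickers that a basic move induces: a rotation of the slice by `90°`
in one sense or the other. -/
def Move.perm {n : ℕ} (m : Move n) : Equiv.Perm (Sticker n) :=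
  if m.sense then quarterTurn m.axis m.layer else (quarterTurn m.axis m.layer)⁻¹

/-- All basic moves except the rotations of the central slices (which exist for odd `n` only): the
moves `F_k, B_k, R_k, L_k, U_k, D_k` with `1 ≤ k ≤ ⌊n / 2⌋` and their inverses. -/
def nonCentralMoves (n : ℕ) : Set (Move n) := {m | 2 * (m.layer : ℕ) + 1 ≠ n}

/-- All `6 n` basic moves, those of the central slices included. -/
def allMoves (n : ℕ) : Set (Move n) := Set.univ

/-- The group of all permutations of the stickers that are induced by sequences of moves
from `M`. -/
def cubeGroup {n : ℕ} (M : Set (Move n)) : Subgroup (Equiv.Perm (Sticker n)) :=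
  Subgroup.closure (Move.perm '' M)

/-- What the cube looks like: the colour that is seen at each sticker place. -/
abbrev Appearance (n : ℕ) : Type := Sticker n → Face

/-- The solved cube: every face shows its own colour. -/
def solved (n : ℕ) : Appearance n := Sticker.face

/-- Permuting the stickers by `g`: the sticker at place `x` is moved to the place `g x`. -/
def permute {n : ℕ} (g : Equiv.Perm (Sticker n)) (s : Appearance n) : Appearance n :=
  fun x => s (g⁻¹ x)

/-- The physically distinct valid configurations: what is obtained from the solved cube by
sequences of moves, where configurations that look the same are identified. -/
def physConfigs {n : ℕ} (M : Set (Move n)) : Set (Appearance n) :=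
  {s | ∃ g ∈ cubeGroup M, s = permute g (solved n)}

/-- Perform the moves of the list, the first entry first. -/
def applyMoves {n : ℕ} (w : List (Move n)) (s : Appearance n) : Appearance n :=
  w.foldl (fun t m => permute m.perm t) s

/-- The configuration `s` can be solved by at most `k` moves from `M`. -/
def SolvableIn {n : ℕ} (M : Set (Move n)) (k : ℕ) (s : Appearance n) : Prop :=
  ∃ w : List (Move n), (∀ m ∈ w, m ∈ M) ∧ w.length ≤ k ∧ applyMoves w s = solved n

/-- God's Number: the least `k` such that every valid configuration can be solved by at most `k`
moves from `M`. -/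
noncomputable def godsNumber {n : ℕ} (M : Set (Move n)) : ℕ :=
  sInf {k : ℕ | ∀ s ∈ physConfigs M, SolvableIn M k s}

end RubikCube

/-!
The lower bound is a counting argument. In each of `k` steps one performs one of the `6 n` basic
moves or none, so at most `(6 n + 1) ^ k` configurations can be solved by `k` moves
(`ncard_solvableIn_le`). It remains to exhibit `2 ^ (c n ^ 2)` valid configurations.

Let `A` be the turn of the slice `x = i`, let `B` be the turn of the slice `x = j` conjugated by
the turn of the top layer, and let `i ≠ j` be different from `0` and `n - 1`. The only sticker
that both `A` and `B` move is the sticker `p` of the top face with coordinates `(i, j)`. Hence the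
commutator `⁅A, B⁆` moves no sticker besides `p`, `A p`, `B p`
(`commutator_apply_of_unique_moved`), and it brings the sticker `B p`, which has another colour,
to the place `p`. For `0 < i ≤ m < j ≤ 2 m` these triples of stickers are pairwise disjoint. So
for every subset of the `m ^ 2` pairs the product of the corresponding commutators leads to a
configuration that shows the subset on the top face (`two_pow_le_ncard_physConfigs`). With
`m = (n - 2) / 4` no central slice is turned, and the same family serves both sets of moves.

`godsNumber` is an infimum of natural numbers, so one also needs that the set in question is not
empty; this holds because there are finitely many configurations and the set of moves is closed
under inversion (`exists_forall_solvableIn`).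
-/

open scoped commutatorElement
namespace RubikCube

/-! ### Words in the moves -/

theorem permute_mul {n : ℕ} (g h : Equiv.Perm (Sticker n)) (s : Appearance n) :
    permute (g * h) s = permute g (permute h s) := by
  funext x
  simp [permute, mul_inv_rev]

theorem permute_one {n : ℕ} (s : Appearance n) : permute 1 s = s := rfl

theorem permute_inv_permute {n : ℕ} (g : Equiv.Perm (Sticker n)) (s : Appearance n) :
    permute g⁻¹ (permute g s) = s := by
  rw [← permute_mul, inv_mul_cancel, permute_one]

theorem applyMoves_append {n : ℕ} (v w : List (Move n)) (s : Appearance n) :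
    applyMoves (v ++ w) s = applyMoves w (applyMoves v s) :=
  List.foldl_append

/-- The rotation of the same slice in the opposite sense. -/
def Move.inv {n : ℕ} (m : Move n) : Move n := ⟨m.axis, m.layer, !m.sense⟩

theorem Move.perm_inv {n : ℕ} (m : Move n) : m.inv.perm = m.perm⁻¹ := by
  obtain ⟨a, k, s⟩ := m
  cases s <;> simp [Move.inv, Move.perm]

theorem exists_applyMoves_eq_permute {n : ℕ} {M : Set (Move n)} (hM : ∀ m ∈ M, m.inv ∈ M)
    {g : Equiv.Perm (Sticker n)} (hg : g ∈ cubeGroup M) :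
    ∃ w : List (Move n), (∀ m ∈ w, m ∈ M) ∧ ∀ s, applyMoves w s = permute g s := by
  induction hg using Subgroup.closure_induction'' with
  | one => exact ⟨[], by simp, fun s => rfl⟩
  | mem x hx =>
    obtain ⟨m, hm, rfl⟩ := hx
    exact ⟨[m], by simpa using hm, fun s => rfl⟩
  | inv_mem x hx =>
    obtain ⟨m, hm, rfl⟩ := hx
    refine ⟨[m.inv], by simpa using hM m hm, fun s => ?_⟩
    rw [← Move.perm_inv]
    rfl
  | mul x y _ _ hx hy =>
    obtain ⟨v, hv, hv'⟩ := hx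
    obtain ⟨w, hw, hw'⟩ := hy
    refine ⟨w ++ v, ?_, fun s => ?_⟩
    · intro m hm
      rcases List.mem_append.1 hm with h | h
      exacts [hw m h, hv m h]
    · rw [applyMoves_append, hw', hv', permute_mul]

instance (n : ℕ) : Finite (Sticker n) :=
  inferInstanceAs (Finite {x : (Fin 3 → Fin n) × Face // OnFace x.1 x.2})

/-- The set of which `godsNumber` is the infimum is nonempty. -/
theorem exists_forall_solvableIn {n : ℕ} {M : Set (Move n)} (hM : ∀ m ∈ M, m.inv ∈ M) :
    ∃ k : ℕ, ∀ s ∈ physConfigs M, SolvableIn M k s := by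
  have key : ∀ s : Appearance n, ∃ k : ℕ, s ∈ physConfigs M → SolvableIn M k s := by
    intro s
    by_cases hs : s ∈ physConfigs M
    · obtain ⟨g, hg, rfl⟩ := hs
      obtain ⟨w, hw, hw'⟩ := exists_applyMoves_eq_permute hM (inv_mem hg)
      exact ⟨w.length, fun _ => ⟨w, hw, le_rfl, by rw [hw', permute_inv_permute]⟩⟩
    · exact ⟨0, fun h => absurd h hs⟩
  choose f hf using key
  obtain ⟨k, hk⟩ := Finite.exists_le f
  refine ⟨k, fun s hs => ?_⟩
  obtain ⟨w, hw, hl, h⟩ := hf s hs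
  exact ⟨w, hw, hl.trans (hk s), h⟩

/-! ### Counting the configurations that few moves solve -/

/-- A move is an axis, a layer and a sense. -/
def moveEquiv (n : ℕ) : Move n ≃ Fin 3 × Fin n × Bool where
  toFun m := (m.axis, m.layer, m.sense)
  invFun t := ⟨t.1, t.2.1, t.2.2⟩
  left_inv _ := rfl
  right_inv _ := rfl

instance (n : ℕ) : Finite (Move n) := Finite.of_equiv _ (moveEquiv n).symm

theorem natCard_move (n : ℕ) : Nat.card (Move n) = 6 * n := by
  rw [Nat.card_congr (moveEquiv n)]
  simp
  ring

theorem ncard_solvableIn_le {n : ℕ} (M : Set (Move n)) (k : ℕ) :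
    {s | SolvableIn M k s}.ncard ≤ (6 * n + 1) ^ k := by
  induction k with
  | zero =>
    have : {s | SolvableIn M 0 s} ⊆ {solved n} := by
      rintro s ⟨w, -, hl, h⟩
      obtain rfl : w = [] := by simpa using hl
      exact h
    simpa using Set.ncard_le_ncard this
  | succ k ih =>
    -- `none` stands for no move; it covers the words that are shorter than allowed.
    have hsub : {s | SolvableIn M (k + 1) s} ⊆
        (fun t : Option (Move n) × Appearance n =>
            t.1.elim t.2 fun m => permute m.perm⁻¹ t.2) ''
          (Set.univ ×ˢ {s | SolvableIn M k s}) := by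
      rintro s ⟨w, hw, hl, h⟩
      cases w with
      | nil => exact ⟨(none, s), ⟨trivial, [], by simp, by simp, h⟩, rfl⟩
      | cons m w =>
        refine ⟨(some m, permute m.perm s), ⟨trivial, w, ?_, ?_, h⟩, permute_inv_permute _ _⟩
        · exact fun x hx => hw x (List.mem_cons_of_mem _ hx)
        · simpa using hl
    calc {s | SolvableIn M (k + 1) s}.ncard
        ≤ _ := Set.ncard_le_ncard hsub
      _ ≤ _ := Set.ncard_image_le (Set.toFinite _)
      _ = (6 * n + 1) * {s | SolvableIn M k s}.ncard := by
        rw [Set.ncard_prod, Set.ncard_univ, Finite.card_option, natCard_move]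
      _ ≤ (6 * n + 1) ^ (k + 1) := by
        rw [pow_succ']
        exact Nat.mul_le_mul_left _ ih

theorem ncard_physConfigs_le {n : ℕ} {M : Set (Move n)} (hM : ∀ m ∈ M, m.inv ∈ M) :
    (physConfigs M).ncard ≤ (6 * n + 1) ^ godsNumber M :=
  (Set.ncard_le_ncard (Nat.sInf_mem (exists_forall_solvableIn hM))).trans
    (ncard_solvableIn_le M _)

/-! ### Commutators of permutations that share one moved point -/

/-- If `p` is the only point moved by both `A` and `B`, then their commutator moves no points
besides `p`, `A p` and `B p`. -/
theorem commutator_apply_of_unique_moved {α : Type*} {A B : Equiv.Perm α} {p : α}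
    (h : ∀ x, A x ≠ x → B x ≠ x → x = p) {x : α} (hp : x ≠ p) (hA : x ≠ A p) (hB : x ≠ B p) :
    ⁅A, B⁆ x = x := by
  rw [commutatorElement_def]
  simp only [Equiv.Perm.mul_apply]
  by_cases hx : B x = x
  · rw [show B⁻¹ x = x from Equiv.Perm.inv_eq_iff_eq.2 hx.symm]
    obtain ⟨y, rfl⟩ := A.surjective x
    have hy : B y = y := by
      by_contra hne
      have hAy : A y = y := by
        by_contra hne'
        exact hA (congrArg A (h y hne' hne))
      rw [hAy] at hx
      exact hne hx
    rw [show A⁻¹ (A y) = y from Equiv.Perm.inv_eq_iff_eq.2 rfl, hy]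
  · have hAx : A x = x := by
      by_contra hne
      exact hp (h x hne hx)
    obtain ⟨y, rfl⟩ := B.surjective x
    have hy : A y = y := by
      by_contra hne
      have hBy : B y = y := by
        by_contra hne'
        exact hB (congrArg B (h y hne hne'))
      exact hx (congrArg B hBy)
    rw [show B⁻¹ (B y) = y from Equiv.Perm.inv_eq_iff_eq.2 rfl,
      show A⁻¹ y = y from Equiv.Perm.inv_eq_iff_eq.2 hy.symm, hAx]

theorem commutator_inv_apply_of_unique_moved {α : Type*} {A B : Equiv.Perm α} {p : α}
    (h : ∀ x, A x ≠ x → B x ≠ x → x = p) (hA : A p ≠ p) : ⁅A, B⁆⁻¹ p = B p := by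
  rw [commutatorElement_inv, commutatorElement_def]
  simp only [Equiv.Perm.mul_apply]
  obtain ⟨y, rfl⟩ := A.surjective p
  have hy : B y = y := by
    by_contra hne
    have hAy : A y ≠ y := fun e => hA (congrArg A e)
    exact hAy (h y hAy hne).symm
  rw [show A⁻¹ (A y) = y from Equiv.Perm.inv_eq_iff_eq.2 rfl,
    show B⁻¹ y = y from Equiv.Perm.inv_eq_iff_eq.2 hy.symm]

theorem list_prod_inv_apply_of_fixed {ι α : Type*} (g : ι → Equiv.Perm α) {x : α} (l : List ι)
    (h : ∀ b ∈ l, g b x = x) : ((l.map g).prod)⁻¹ x = x := by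
  induction l with
  | nil => rfl
  | cons b l ih =>
    rw [List.map_cons, List.prod_cons, mul_inv_rev, Equiv.Perm.mul_apply,
      Equiv.Perm.inv_eq_iff_eq.2 (h b List.mem_cons_self).symm]
    exact ih fun c hc => h c (List.mem_cons_of_mem _ hc)

/-- If only the factor `g a` moves `p`, and only that factor moves the point `q` that it sends to
`p`, then the whole product sends `q` to `p`. -/
theorem list_prod_inv_apply {ι α : Type*} (g : ι → Equiv.Perm α) {a : ι} {p q : α}
    (hp : ∀ b, b ≠ a → g b p = p) (hq : ∀ b, b ≠ a → g b q = q) (hpq : (g a)⁻¹ p = q)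
    (l : List ι) (hl : l.Nodup) (ha : a ∈ l) : ((l.map g).prod)⁻¹ p = q := by
  induction l with
  | nil => simp at ha
  | cons b l ih =>
    rw [List.nodup_cons] at hl
    rw [List.map_cons, List.prod_cons, mul_inv_rev, Equiv.Perm.mul_apply]
    by_cases hb : b = a
    · subst hb
      rw [hpq]
      exact list_prod_inv_apply_of_fixed g l fun c hc => hq c (by rintro rfl; exact hl.1 hc)
    · rw [Equiv.Perm.inv_eq_iff_eq.2 (hp b hb).symm]
      exact ih hl.2 (List.mem_of_ne_of_mem (Ne.symm hb) ha)

/-! ### Commutators of slice turns -/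

/-- The sticker of the top face with first coordinates `i`, `j`. -/
def topSticker {n : ℕ} (i j : Fin (n + 1)) : Sticker (n + 1) :=
  ⟨(![i, j, Fin.last n], (2, true)), by simp [OnFace]⟩

/-- The sticker with coordinates `i`, `k` on the face where the second coordinate is `0`. -/
def frontSticker {n : ℕ} (i k : Fin (n + 1)) : Sticker (n + 1) :=
  ⟨(![i, 0, k], (1, false)), by simp [OnFace]⟩

theorem topSticker_inj {n : ℕ} {i j i' j' : Fin (n + 1)} :
    topSticker i j = topSticker i' j' ↔ i = i' ∧ j = j' := by
  refine ⟨fun h => ?_, by rintro ⟨rfl, rfl⟩; rfl⟩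
  exact ⟨congrFun (congrArg Sticker.pos h) 0, congrFun (congrArg Sticker.pos h) 1⟩

theorem frontSticker_inj {n : ℕ} {i j i' j' : Fin (n + 1)} :
    frontSticker i j = frontSticker i' j' ↔ i = i' ∧ j = j' := by
  refine ⟨fun h => ?_, by rintro ⟨rfl, rfl⟩; rfl⟩
  exact ⟨congrFun (congrArg Sticker.pos h) 0, congrFun (congrArg Sticker.pos h) 2⟩

theorem topSticker_ne_frontSticker {n : ℕ} {i j i' j' : Fin (n + 1)} :
    topSticker i j ≠ frontSticker i' j' := fun h => by
  simpa [Sticker.face, topSticker, frontSticker] using congrArg Sticker.face h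

theorem pos_eq_of_quarterTurn_ne {n : ℕ} {a : Fin 3} {k : Fin n} {x : Sticker n}
    (h : quarterTurn a k x ≠ x) : x.pos a = k := by
  by_contra hne
  exact h (if_neg hne)

theorem quarterTurn_topSticker {n : ℕ} (i j : Fin (n + 1)) :
    quarterTurn 0 i (topSticker i j) = frontSticker i j := by
  refine (if_pos rfl).trans (Subtype.ext (Prod.ext ?_ rfl))
  funext l
  fin_cases l <;> simp [rotPos, topSticker, frontSticker, Sticker.pos]

theorem topTurn_topSticker {n : ℕ} (i j : Fin (n + 1)) :
    quarterTurn 2 (Fin.last n) (topSticker i j) = topSticker j.rev i := by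
  refine (if_pos rfl).trans (Subtype.ext (Prod.ext ?_ rfl))
  funext l
  fin_cases l <;> simp [rotPos, topSticker, Sticker.pos]

/-- The turn of the slice `j` of the first axis, conjugated by the turn of the top layer. Inside
the top face it affects the row of the stickers whose second coordinate is `j`. -/
def conjTurn {n : ℕ} (j : Fin (n + 1)) : Equiv.Perm (Sticker (n + 1)) :=
  quarterTurn 2 (Fin.last n) * quarterTurn 0 j * (quarterTurn 2 (Fin.last n))⁻¹

theorem conjTurn_topSticker {n : ℕ} {i : Fin (n + 1)} (hi : i ≠ 0) (j : Fin (n + 1)) :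
    conjTurn j (topSticker i j) = frontSticker j i.rev := by
  have h : (quarterTurn 2 (Fin.last n))⁻¹ (topSticker i j) = topSticker j i.rev := by
    rw [Equiv.Perm.inv_eq_iff_eq, topTurn_topSticker, Fin.rev_rev]
  rw [conjTurn, Equiv.Perm.mul_apply, Equiv.Perm.mul_apply, h, quarterTurn_topSticker]
  by_contra hne
  have := pos_eq_of_quarterTurn_ne hne
  have h2 : i.rev = Fin.last n := this
  exact hi (by simpa using congrArg Fin.rev h2)

theorem face_eq_top {n : ℕ} {y : Sticker (n + 1)} (h0 : y.pos 0 ≠ 0) (h0' : y.pos 0 ≠ Fin.last n)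
    (h1 : y.pos 1 ≠ 0) (h1' : y.pos 1 ≠ Fin.last n) (h2 : y.pos 2 ≠ 0) : y.face = (2, true) := by
  obtain ⟨⟨p, f, s⟩, hf⟩ := y
  fin_cases f <;> cases s
  exacts [absurd hf (Fin.val_injective.ne h0), absurd hf (Fin.val_injective.ne h0'),
    absurd hf (Fin.val_injective.ne h1), absurd hf (Fin.val_injective.ne h1'),
    absurd hf (Fin.val_injective.ne h2), rfl]

/-- The turn of an inner slice and the conjugated turn of another one move only one common sticker. -/
theorem eq_topSticker_of_ne {n : ℕ} {i j : Fin (n + 1)} (hij : i ≠ j)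
    (hi0 : i ≠ 0) (hi : i ≠ Fin.last n) (hj0 : j ≠ 0) (hj : j ≠ Fin.last n)
    {x : Sticker (n + 1)} (hA : quarterTurn 0 i x ≠ x) (hB : conjTurn j x ≠ x) :
    x = topSticker i j := by
  have h0 := pos_eq_of_quarterTurn_ne hA
  obtain ⟨y, rfl⟩ := (quarterTurn 2 (Fin.last n)).surjective x
  have hy : y.pos 0 = j := by
    refine pos_eq_of_quarterTurn_ne fun h => hB ?_
    simp [conjTurn, h]
  -- The turn of the top layer moves `y`, for otherwise `y` lies in the slices `i` and `j`.
  have hy2 : y.pos 2 = Fin.last n := by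
    refine pos_eq_of_quarterTurn_ne fun h => hij ?_
    rw [← h0, h, hy]
  have hturn : (quarterTurn 2 (Fin.last n) y).pos = rotPos 2 y.pos :=
    congrArg Sticker.pos (if_pos hy2)
  have h1 : (y.pos 1).rev = i := by
    rw [hturn] at h0
    simpa [rotPos] using h0
  -- As `i` and `j` are inner layers, the cubie of `y` has a sticker on the top face only.
  have hface : y.face = (2, true) := by
    refine face_eq_top (hy ▸ hj0) (hy ▸ hj) (fun e => hi ?_) (fun e => hi0 ?_) ?_
    · rw [← h1, e, Fin.rev_zero]
    · rw [← h1, e, Fin.rev_last]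
    · rw [hy2]
      rintro e
      exact hi0 (Fin.le_zero_iff.1 (e ▸ Fin.le_last i))
  have : y = topSticker j i.rev := by
    refine Subtype.ext (Prod.ext ?_ hface)
    funext l
    fin_cases l
    · exact hy
    · rw [← h1]
      simp [topSticker, Sticker.pos]
    · exact hy2
  rw [this, topTurn_topSticker, Fin.rev_rev]

/-- The three-cycle of the stickers `topSticker i j`, `frontSticker i j` and
`frontSticker j i.rev`, for different inner layers `i` and `j`. -/
def threeCycle {n : ℕ} (i j : Fin (n + 1)) : Equiv.Perm (Sticker (n + 1)) :=
  ⁅quarterTurn 0 i, conjTurn j⁆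

theorem threeCycle_apply {n : ℕ} {i j : Fin (n + 1)} (hij : i ≠ j)
    (hi0 : i ≠ 0) (hi : i ≠ Fin.last n) (hj0 : j ≠ 0) (hj : j ≠ Fin.last n)
    {x : Sticker (n + 1)} (h1 : x ≠ topSticker i j) (h2 : x ≠ frontSticker i j)
    (h3 : x ≠ frontSticker j i.rev) : threeCycle i j x = x := by
  refine commutator_apply_of_unique_moved
    (fun x => eq_topSticker_of_ne hij hi0 hi hj0 hj) h1 ?_ ?_
  · rwa [quarterTurn_topSticker]
  · rwa [conjTurn_topSticker hi0]

theorem threeCycle_inv_topSticker {n : ℕ} {i j : Fin (n + 1)} (hij : i ≠ j)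
    (hi0 : i ≠ 0) (hi : i ≠ Fin.last n) (hj0 : j ≠ 0) (hj : j ≠ Fin.last n) :
    (threeCycle i j)⁻¹ (topSticker i j) = frontSticker j i.rev := by
  rw [threeCycle, commutator_inv_apply_of_unique_moved
    (fun x => eq_topSticker_of_ne hij hi0 hi hj0 hj), conjTurn_topSticker hi0]
  rw [quarterTurn_topSticker]
  exact topSticker_ne_frontSticker.symm

theorem quarterTurn_mem_cubeGroup {n : ℕ} {M : Set (Move n)} {a : Fin 3} {k : Fin n}
    (h : ⟨a, k, true⟩ ∈ M) : quarterTurn a k ∈ cubeGroup M :=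
  Subgroup.subset_closure ⟨_, h, rfl⟩

theorem threeCycle_mem_cubeGroup {n : ℕ} (hn : n ≠ 0) {i j : Fin (n + 1)}
    (hi : 2 * (i : ℕ) ≠ n) (hj : 2 * (j : ℕ) ≠ n) :
    threeCycle i j ∈ cubeGroup (nonCentralMoves (n + 1)) := by
  have hA : quarterTurn 0 i ∈ cubeGroup (nonCentralMoves (n + 1)) :=
    quarterTurn_mem_cubeGroup (by simpa [nonCentralMoves] using hi)
  have hX : quarterTurn 0 j ∈ cubeGroup (nonCentralMoves (n + 1)) :=
    quarterTurn_mem_cubeGroup (by simpa [nonCentralMoves] using hj)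
  have hF : quarterTurn 2 (Fin.last n) ∈ cubeGroup (nonCentralMoves (n + 1)) :=
    quarterTurn_mem_cubeGroup fun h => hn (by simp only [Fin.val_last] at h; omega)
  have hB := mul_mem (mul_mem hF hX) (inv_mem hF)
  exact mul_mem (mul_mem (mul_mem hA hB) (inv_mem hA)) (inv_mem hB)

/-! ### Many configurations -/

/-- Every subset of `m ^ 2` places of the top face is the set of those of these places that show
a foreign colour in some valid configuration. -/
theorem two_pow_le_ncard_physConfigs {n m : ℕ} (h : 4 * m < n) :
    2 ^ (m ^ 2) ≤ (physConfigs (nonCentralMoves (n + 1))).ncard := by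
  let lo : Fin m → Fin (n + 1) := fun a => ⟨a + 1, by omega⟩
  let hi : Fin m → Fin (n + 1) := fun a => ⟨m + 1 + a, by omega⟩
  have lo_inj : ∀ {a b}, lo a = lo b → a = b := fun {a b} e => by
    simp only [lo, Fin.mk.injEq] at e
    omega
  have hi_inj : ∀ {a b}, hi a = hi b → a = b := fun {a b} e => by
    simp only [hi, Fin.mk.injEq] at e
    omega
  have lo_ne_hi : ∀ a b, lo a ≠ hi b := fun a b e => by
    simp only [lo, hi, Fin.mk.injEq] at e
    omega
  have lo_ne_zero : ∀ a, lo a ≠ 0 := fun a e => by simp [lo, Fin.ext_iff] at e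
  have hi_ne_zero : ∀ a, hi a ≠ 0 := fun a e => by simp [hi, Fin.ext_iff] at e
  have lo_ne_last : ∀ a, lo a ≠ Fin.last n := fun a e => by
    simp only [lo, Fin.ext_iff, Fin.val_last] at e
    omega
  have hi_ne_last : ∀ a, hi a ≠ Fin.last n := fun a e => by
    simp only [hi, Fin.ext_iff, Fin.val_last] at e
    omega
  let g : Fin m × Fin m → Equiv.Perm (Sticker (n + 1)) := fun a => threeCycle (lo a.1) (hi a.2)
  let p : Fin m × Fin m → Sticker (n + 1) := fun a => topSticker (lo a.1) (hi a.2)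
  let q : Fin m × Fin m → Sticker (n + 1) := fun a => frontSticker (hi a.2) (lo a.1).rev
  have hgp : ∀ a b, b ≠ a → g b (p a) = p a := fun a b hab => by
    refine threeCycle_apply (lo_ne_hi _ _) (lo_ne_zero _) (lo_ne_last _) (hi_ne_zero _)
      (hi_ne_last _) (fun e => ?_) topSticker_ne_frontSticker topSticker_ne_frontSticker
    obtain ⟨e1, e2⟩ := topSticker_inj.1 e
    exact hab (Prod.ext (lo_inj e1).symm (hi_inj e2).symm)
  have hgq : ∀ a b, b ≠ a → g b (q a) = q a := fun a b hab => by
    refine threeCycle_apply (lo_ne_hi _ _) (lo_ne_zero _) (lo_ne_last _) (hi_ne_zero _)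
      (hi_ne_last _) topSticker_ne_frontSticker.symm (fun e => ?_) (fun e => ?_)
    · exact lo_ne_hi _ _ (frontSticker_inj.1 e).1.symm
    · obtain ⟨e1, e2⟩ := frontSticker_inj.1 e
      exact hab (Prod.ext (lo_inj (Fin.rev_injective e2)).symm (hi_inj e1).symm)
  have hgpq : ∀ a, (g a)⁻¹ (p a) = q a := fun a =>
    threeCycle_inv_topSticker (lo_ne_hi _ _) (lo_ne_zero _) (lo_ne_last _) (hi_ne_zero _)
      (hi_ne_last _)
  have hmem : ∀ a, g a ∈ cubeGroup (nonCentralMoves (n + 1)) := fun a =>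
    threeCycle_mem_cubeGroup (by omega) (by simp only [lo]; omega) (by simp only [hi]; omega)
  let config : Finset (Fin m × Fin m) → Appearance (n + 1) := fun S =>
    permute (S.toList.map g).prod (solved (n + 1))
  have hconfig : ∀ S a, config S (p a) = (1, false) ↔ a ∈ S := fun S a => by
    have hS : config S (p a) = ((S.toList.map g).prod⁻¹ (p a)).face := rfl
    rw [hS]
    by_cases ha : a ∈ S
    · rw [list_prod_inv_apply g (hgp a) (hgq a) (hgpq a) _ S.nodup_toList (by simpa using ha)]
      exact ⟨fun _ => ha, fun _ => rfl⟩
    · rw [list_prod_inv_apply_of_fixed g _ fun b hb => hgp a b ?_]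
      · exact ⟨fun e => by simp [p, topSticker, Sticker.face] at e, fun e => absurd e ha⟩
      · rintro rfl
        exact ha (by simpa using hb)
  have config_inj : Function.Injective config := fun S T e => by
    ext a
    rw [← hconfig, e, hconfig]
  have hsub : Set.range config ⊆ physConfigs (nonCentralMoves (n + 1)) := by
    rintro _ ⟨S, rfl⟩
    refine ⟨_, Subgroup.list_prod_mem _ fun x hx => ?_, rfl⟩
    obtain ⟨a, -, rfl⟩ := List.mem_map.1 hx
    exact hmem a
  calc 2 ^ (m ^ 2) = (Set.range config).ncard := by
        rw [← Set.image_univ, Set.ncard_image_of_injective _ config_inj, Set.ncard_univ]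
        simp [sq]
    _ ≤ _ := Set.ncard_le_ncard hsub

theorem physConfigs_mono {n : ℕ} {M M' : Set (Move n)} (h : M ⊆ M') :
    physConfigs M ⊆ physConfigs M' := by
  rintro s ⟨g, hg, rfl⟩
  exact ⟨g, Subgroup.closure_mono (Set.image_mono h) hg, rfl⟩

/-- A set of moves that is closed under inversion and contains the moves of the noncentral slices
has God's Number of order at least `n ^ 2 / log n`. The constant comes from
`m = (n - 2) / 4 ≥ n / 8` and `6 n + 1 ≤ n ^ 2`. -/
theorem sq_div_log_isBigO_godsNumber (M : ∀ n : ℕ, Set (Move n))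
    (hM : ∀ n, ∀ m ∈ M n, m.inv ∈ M n) (hsub : ∀ n, nonCentralMoves n ⊆ M n) :
    (fun n : ℕ => (n : ℝ) ^ 2 / Real.log n) =O[atTop] fun n : ℕ => (godsNumber (M n) : ℝ) := by
  refine IsBigO.of_bound (128 / Real.log 2) ?_
  filter_upwards [eventually_ge_atTop 10] with n hn
  have hlog2 : 0 < Real.log 2 := Real.log_pos one_lt_two
  have hn' : (10 : ℝ) ≤ n := by exact_mod_cast hn
  have hlog : 0 < Real.log n := Real.log_pos (by linarith)
  rw [Real.norm_of_nonneg (by positivity), Real.norm_of_nonneg (by positivity)]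
  obtain ⟨m, hm⟩ : ∃ m, m = (n - 2) / 4 := ⟨_, rfl⟩
  have hcount : 2 ^ (m ^ 2) ≤ (6 * n + 1) ^ godsNumber (M n) := by
    obtain ⟨k, rfl⟩ : ∃ k, n = k + 1 := ⟨n - 1, by omega⟩
    exact (two_pow_le_ncard_physConfigs (by omega)).trans
      ((Set.ncard_le_ncard (physConfigs_mono (hsub _))).trans (ncard_physConfigs_le (hM _)))
  have hmn : (n : ℝ) ≤ 8 * m := by
    have : n ≤ 8 * m := by omega
    exact_mod_cast this
  have hlogcount : (m : ℝ) ^ 2 * Real.log 2 ≤ godsNumber (M n) * (2 * Real.log n) := by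
    have hle : (2 : ℝ) ^ (m ^ 2) ≤ ((n : ℝ) ^ 2) ^ godsNumber (M n) := by
      calc (2 : ℝ) ^ (m ^ 2) ≤ (6 * n + 1) ^ godsNumber (M n) := by exact_mod_cast hcount
        _ ≤ _ := by
          gcongr
          nlinarith
    have := Real.log_le_log (by positivity) hle
    rw [Real.log_pow, Real.log_pow, Real.log_pow] at this
    exact_mod_cast this
  rw [div_le_iff₀ hlog, div_mul_eq_mul_div, div_mul_eq_mul_div, le_div_iff₀ hlog2]
  have hsq : (n : ℝ) ^ 2 ≤ 64 * (m : ℝ) ^ 2 := by nlinarith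
  nlinarith [mul_le_mul_of_nonneg_right hsq hlog2.le]

end RubikCube

theorem mainTheorem7 :
    ((fun n : ℕ => (n : ℝ) ^ 2 / Real.log n) =O[atTop]
        fun n : ℕ => (RubikCube.godsNumber (RubikCube.nonCentralMoves n) : ℝ)) ∧
      ((fun n : ℕ => (n : ℝ) ^ 2 / Real.log n) =O[atTop]
        fun n : ℕ => (RubikCube.godsNumber (RubikCube.allMoves n) : ℝ)) :=
  ⟨RubikCube.sq_div_log_isBigO_godsNumber _ (fun _ _ h => h) fun _ => subset_rfl,
    RubikCube.sq_div_log_isBigO_godsNumber _ (fun _ _ h => h) fun _ => Set.subset_univ _⟩
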